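/- For a topological space $X$ let $w(X)$ (weight) be the least cardinality of a base of $X$ and $d(X)$ (density) the least cardinality of a dense subset; for a topological group let the local weight be the least cardinality of a base of open neighbourhoods of the identity. For an infinite cardinal $\tau$ let $\ln\tau$ be the least cardinal $\kappa$ with $2^\kappa\ge\tau$. Topological groups are Hausdorff, and the non-trivial quotient groups of $K$ are the quotients $K/M$ by closed normal subgroups $M\neq K$. A topological group is topologically simple if it is non-trivial and has no closed normal subgroups other than $\mathbf 1$ and itself. Theorem. For every infinite cardinal $\mu$ there exists a locally compact group $K$ that is not totally disconnected and all of whose non-trivial quotient groups have local weight $\ge 2^\mu$ and density $\ge\mu$. More precisely, there are a connected compact simple (in particular non-trivial) group $N$, a totally disconnected, locally compact, topologically simple group $G$ and a proper compact open subgroup $H$ of $G$ with $\ln w(H)\ge\mu$ such that the following holds. Let $X=G/H$ be the discrete space of left cosets, and let $K=N\wr G=N^X\rtimes G$ be the wreath product, where $g\in G$ acts on $N^X$ by $(g\cdot f)(x)=f(g^{-1}x)$, with the product topology of $N^X$ and $G$. Then $K$ is a locally compact group that is not totally disconnected; its closed normal subgroups are exactly $\mathbf 1$, $N^X$ and $K$;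 and every non-trivial quotient group of $K$ has local weight $\ge 2^\mu$ and density $\ge \mu$. Consequently, the question of Leiderman, Morris and Tkachenko whether every non-totally-disconnected locally compact group has a non-trivial separable quotient group has a negative answer. -/

import Mathlib

open Cardinal Topology TopologicalSpace

universe u v w

noncomputable section

/-- The density of a topological space: the least cardinality of a dense subset. -/
def density (X : Type u) [TopologicalSpace X] : Cardinal.{u} :=
  ⨅ s : {s : Set X // Dense s}, #(s : Set X)

/-- The weight of a topological space: the least cardinality of a base of its topology. -/
def weight (X : Type u) [TopologicalSpace X] : Cardinal.{u} :=
  ⨅ B : {B : Set (Set X) // IsTopologicalBasis B}, #(B : Set (Set X))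

/-- The local weight (character) of a topological group: the least cardinality of a
base of open neighbourhoods of the identity. -/
def localWeight (G : Type u) [Group G] [TopologicalSpace G] : Cardinal.{u} :=
  ⨅ B : {B : Set (Set G) // (∀ U ∈ B, IsOpen U ∧ (1 : G) ∈ U) ∧
      ∀ V ∈ 𝓝 (1 : G), ∃ U ∈ B, U ⊆ V}, #(B : Set (Set G))

/-- For an infinite cardinal `τ`, the least cardinal `κ` with `τ ≤ 2 ^ κ`. -/
def cardinalLn (τ : Cardinal.{u}) : Cardinal.{u} :=
  sInf {κ : Cardinal.{u} | τ ≤ 2 ^ κ}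

/-- A topological group is topologically simple if it is non-trivial and its only closed
normal subgroups are the trivial subgroup and the whole group. -/
structure IsTopologicallySimple (G : Type u) [Group G] [TopologicalSpace G] : Prop where
  nontrivial : Nontrivial G
  eq_bot_or_eq_top : ∀ M : Subgroup G, M.Normal → IsClosed (M : Set G) → M = ⊥ ∨ M = ⊤

/-- The natural product topology on a semidirect product. -/
instance semidirectProductTopology {A : Type u} {B : Type v} [Group A] [Group B]
    [TopologicalSpace A] [TopologicalSpace B] (φ : B →* MulAut A) :
    TopologicalSpace (A ⋊[φ] B) :=
  TopologicalSpace.induced (fun k => (k.left, k.right)) instTopologicalSpaceProd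

/-- The (unrestricted) wreath product `N ≀ G = N ^ X ⋊ G` of `N` by `G` via an action of `G`
on `X`; here `G` acts on `N ^ X` by `(g • f) x = f (g⁻¹ • x)`. It carries the product topology
of `N ^ X` (itself with the product topology) and `G`. -/
abbrev WreathProduct (N : Type u) (G : Type v) (X : Type w) [Group N] [Group G]
    [MulAction G X] : Type (max u v w) :=
  (X → N) ⋊[(mulAutArrow : G →* MulAut (X → N))] G

/-- The base group `N ^ X` of the wreath product, as a subgroup. -/
def WreathProduct.base (N : Type u) (G : Type v) (X : Type w) [Group N] [Group G]
    [MulAction G X] : Subgroup (WreathProduct N G X) :=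
  (SemidirectProduct.inl : (X → N) →* WreathProduct N G X).range

end

/-!
The group `N` is the group of unit quaternions modulo its centre. Two unit quaternions with the
same real part are conjugate, and by connectedness the real parts of the commutators of a
non-central element fill an interval ending at `1`; so a normal subgroup that is not central
contains a neighbourhood of the identity, and is everything
(`Quaternion.eq_top_of_not_le_center`).

The group `G` consists of the permutations of `I × {1, -1}` of the form `f * τ`, where `τ` is
finitary and `f`, an element of `H = {1, -1} ^ I`, exchanges the points of some of the blocks
`{i} × {1, -1}`. A finitary permutation commutes with almost all coordinates of `H`, so there is a
group topology on `G` for which `H` is open and carries the compact product topology. For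
topological simplicity, let `M` be a non-trivial closed normal subgroup of `G`. Commutators with
transpositions show that `M` contains a product of two disjoint transpositions, hence the product
of any transposition with the exchange of any block away from it. The exchange of the block `i`
tends to `1` as `i` goes to infinity, so `M` contains all transpositions, then all finitary
permutations, and by density `H` (`blockPermGroup_le_of_ne_bot`). A base at the identity of `G` has
at least `#I` members because the finite sets of coordinates it restricts have to cover `I`
(`BlockGroup.mk_le_localWeight`). The choice `#I = 2 ^ 2 ^ μ` gives the claims about the weight of
`H`, and, since the local weight of a topological group is at most `2 ^ d` for its density `d`
(`localWeight_le_two_power_density`), it also gives `μ ≤ d` for the density of `G`.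

In the wreath product, a normal subgroup meeting the base group `N ^ X` trivially centralises it
and so is trivial, `G` acting faithfully on `X` and `N` being centreless. A closed normal subgroup
meeting it non-trivially contains a commutator supported at one point, hence one copy of `N`,
hence all copies, hence `N ^ X`; what remains is a closed normal subgroup of `G`. Every non-trivial
quotient therefore maps continuously and openly onto `G`, and inherits the lower bounds.
-/

/-! ### Cardinal invariants -/

/-- An open continuous homomorphism carries a base at the identity to a base at the identity;
surjectivity is not needed. -/
theorem localWeight_le_of_isOpenMap {A B : Type u} [Group A] [TopologicalSpace A] [Group B]
    [TopologicalSpace B] (f : A →* B) (hf : Continuous f) (ho : IsOpenMap f) :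
    localWeight B ≤ localWeight A := by
  have : Nonempty {S : Set (Set A) // (∀ U ∈ S, IsOpen U ∧ (1 : A) ∈ U) ∧
      ∀ V ∈ 𝓝 (1 : A), ∃ U ∈ S, U ⊆ V} :=
    ⟨{U | IsOpen U ∧ (1 : A) ∈ U}, fun U hU => hU, fun V hV => by
      obtain ⟨U, hUV, hU, h1⟩ := mem_nhds_iff.1 hV
      exact ⟨U, ⟨hU, h1⟩, hUV⟩⟩
  refine le_ciInf fun ⟨S, hS, hS'⟩ => ?_
  refine (ciInf_le' _ ⟨(f '' ·) '' S, ?_, fun V hV => ?_⟩).trans (mk_image_le (s := S))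
  · rintro _ ⟨U, hU, rfl⟩
    exact ⟨ho U (hS U hU).1, 1, (hS U hU).2, map_one f⟩
  · obtain ⟨U, hU, hUV⟩ := hS' (f ⁻¹' V) (hf.continuousAt.preimage_mem_nhds (by rwa [map_one]))
    exact ⟨_, ⟨U, hU, rfl⟩, Set.image_subset_iff.2 hUV⟩

theorem localWeight_le_weight (G : Type u) [Group G] [TopologicalSpace G] :
    localWeight G ≤ weight G := by
  have : Nonempty {B : Set (Set G) // IsTopologicalBasis B} := ⟨_, isTopologicalBasis_opens⟩
  refine le_ciInf fun ⟨B, hB⟩ => ?_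
  refine (ciInf_le' _ ⟨{U ∈ B | (1 : G) ∈ U}, fun U hU => ⟨hB.isOpen hU.1, hU.2⟩,
    fun V hV => ?_⟩).trans (mk_le_mk_of_subset (Set.sep_subset _ _))
  obtain ⟨U, hU, h1, hUV⟩ := hB.mem_nhds_iff.1 hV
  exact ⟨U, ⟨hU, h1⟩, hUV⟩

theorem Subgroup.localWeight_le_weight_of_isOpen {G : Type u} [Group G] [TopologicalSpace G]
    (H : Subgroup G) (hH : IsOpen (H : Set G)) : localWeight G ≤ weight H :=
  (localWeight_le_of_isOpenMap H.subtype continuous_subtype_val hH.isOpenMap_subtype_val).trans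
    (localWeight_le_weight H)

theorem density_le_of_surjective {A B : Type u} [TopologicalSpace A] [TopologicalSpace B]
    {f : A → B} (hf : Continuous f) (hs : Function.Surjective f) : density B ≤ density A := by
  have : Nonempty {s : Set A // Dense s} := ⟨_, dense_univ⟩
  refine le_ciInf fun ⟨s, hs'⟩ => ?_
  exact (ciInf_le' _ ⟨f '' s, hs.denseRange.dense_image hf hs'⟩).trans (mk_image_le (s := s))

theorem density_le_aleph0 (A : Type u) [TopologicalSpace A] [SeparableSpace A] :
    density A ≤ ℵ₀ := by
  obtain ⟨s, hs, hd⟩ := exists_countable_dense A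
  exact (ciInf_le' _ ⟨s, hd⟩).trans hs.le_aleph0

/-- Every topological group is regular, so the interiors of the closures of the subsets of a
dense set contain a base at the identity. -/
theorem localWeight_le_two_power_density (G : Type u) [Group G] [TopologicalSpace G]
    [IsTopologicalGroup G] : localWeight G ≤ 2 ^ density G := by
  have : Nonempty {s : Set G // Dense s} := ⟨_, dense_univ⟩
  obtain ⟨⟨s, hs⟩, h : #s = density G⟩ :=
    ciInf_mem (fun s : {s : Set G // Dense s} => #(s : Set G))
  rw [← h, ← mk_powerset]
  refine (ciInf_le' _ ⟨{U ∈ (fun A => interior (closure A)) '' s.powerset | (1 : G) ∈ U},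
    ?_, fun V hV => ?_⟩).trans ((mk_le_mk_of_subset (Set.sep_subset _ _)).trans mk_image_le)
  · rintro _ ⟨⟨A, -, rfl⟩, h1⟩
    exact ⟨isOpen_interior, h1⟩
  · obtain ⟨C, hC, hCc, hCV⟩ := exists_mem_nhds_isClosed_subset hV
    obtain ⟨W, hWC, hW, h1⟩ := mem_nhds_iff.1 hC
    refine ⟨_, ⟨⟨W ∩ s, Set.inter_subset_right, rfl⟩,
      mem_interior.2 ⟨W, hs.open_subset_closure_inter hW, hW, h1⟩⟩, ?_⟩
    exact interior_subset.trans ((closure_minimal (Set.inter_subset_left.trans hWC) hCc).trans hCV)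

theorem le_cardinalLn_of_two_power_lt {μ τ : Cardinal.{u}} (h : 2 ^ μ < τ) :
    μ ≤ cardinalLn τ :=
  le_csInf ⟨τ, (cantor τ).le⟩ fun κ (hκ : τ ≤ 2 ^ κ) => by
    by_contra! hlt
    exact (h.trans_le hκ).not_ge (power_le_power_left two_ne_zero hlt.le)

theorem le_density_of_two_power_lt_localWeight {G : Type u} [Group G] [TopologicalSpace G]
    [IsTopologicalGroup G] {μ : Cardinal.{u}} (h : 2 ^ μ < localWeight G) : μ ≤ density G := by
  by_contra! hlt
  exact (h.trans_le (localWeight_le_two_power_density G)).not_ge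
    (power_le_power_left two_ne_zero hlt.le)

/-! ### Permutations of a union of two-element blocks -/

section BlockPerm

variable (I : Type u)

/-- The Cartesian power of the group with two elements, acting on `I × ℤˣ` block by block: `f`
exchanges the two points of the block `{i} × ℤˣ` exactly when `f i = -1`. -/
def blockPerm : (I → ℤˣ) →* Equiv.Perm (I × ℤˣ) where
  toFun f :=
    { toFun := fun p => (p.1, f p.1 * p.2)
      invFun := fun p => (p.1, (f p.1)⁻¹ * p.2)
      left_inv := fun p => by simp only [inv_mul_cancel_left]
      right_inv := fun p => by simp only [mul_inv_cancel_left] }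
  map_one' := by ext p <;> simp
  map_mul' f g := by ext p <;> simp [mul_assoc]

/-- The finitary permutations of a set. -/
def finitaryPerm (α : Type u) : Subgroup (Equiv.Perm α) :=
  open Classical in Subgroup.closure {σ | σ.IsSwap}

/-- The group of permutations of `I × ℤˣ` which are the product of a permutation preserving all
blocks and a finitary one. -/
def blockPermGroup : Subgroup (Equiv.Perm (I × ℤˣ)) :=
  (blockPerm I).range ⊔ finitaryPerm (I × ℤˣ)

variable {I}

@[simp]
theorem blockPerm_apply (f : I → ℤˣ) (p : I × ℤˣ) : blockPerm I f p = (p.1, f p.1 * p.2) := rfl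

theorem blockPerm_injective : Function.Injective (blockPerm I) := fun f g h => by
  funext i
  simpa using congrArg (fun σ : Equiv.Perm (I × ℤˣ) => (σ (i, 1)).2) h

theorem mem_finitaryPerm {α : Type u} {σ : Equiv.Perm α} :
    σ ∈ finitaryPerm α ↔ {x | σ x ≠ x}.Finite := by
  classical
  exact mem_closure_isSwap'

theorem swap_mem_finitaryPerm {α : Type u} [DecidableEq α] (x y : α) :
    Equiv.swap x y ∈ finitaryPerm α :=
  mem_finitaryPerm.2 <| (Set.toFinite {x, y}).subset fun z hz => by
    by_contra h
    simp only [Set.mem_insert_iff, Set.mem_singleton_iff, not_or] at h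
    exact hz (Equiv.swap_apply_of_ne_of_ne h.1 h.2)

theorem finitaryPerm_le {α : Type u} [DecidableEq α] {M : Subgroup (Equiv.Perm α)}
    (h : ∀ x y, x ≠ y → Equiv.swap x y ∈ M) : finitaryPerm α ≤ M := by
  refine (Subgroup.closure_le _).2 ?_
  rintro _ ⟨x, y, hxy, rfl⟩
  convert! h x y hxy

instance finitaryPerm_normal (α : Type u) : (finitaryPerm α).Normal where
  conj_mem σ hσ g := by
    rw [mem_finitaryPerm] at hσ ⊢
    refine (hσ.image g).subset fun x hx => ⟨g⁻¹ x, fun h => hx ?_, g.apply_symm_apply x⟩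
    rw [Equiv.Perm.mul_apply, Equiv.Perm.mul_apply, h]
    exact g.apply_symm_apply x

theorem mem_blockPermGroup {σ : Equiv.Perm (I × ℤˣ)} :
    σ ∈ blockPermGroup I ↔ ∃ f, ∃ τ ∈ finitaryPerm (I × ℤˣ), blockPerm I f * τ = σ := by
  simp [blockPermGroup, Subgroup.mem_sup_of_normal_right]

theorem blockPerm_mem (f : I → ℤˣ) : blockPerm I f ∈ blockPermGroup I :=
  (le_sup_left : (blockPerm I).range ≤ _) ⟨f, rfl⟩

theorem finitaryPerm_le_blockPermGroup : finitaryPerm (I × ℤˣ) ≤ blockPermGroup I :=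
  le_sup_right

theorem blockPerm_mulSingle [DecidableEq I] (i : I) :
    blockPerm I (Pi.mulSingle i (-1)) = Equiv.swap (i, 1) (i, -1) := by
  ext1 ⟨j, e⟩
  rcases eq_or_ne j i with rfl | h
  · rcases Int.units_eq_one_or e with rfl | rfl <;> simp
  · rw [Equiv.swap_apply_of_ne_of_ne (by simp [h]) (by simp [h])]
    simp [h]

/-- A finitary permutation commutes with all block permutations that fix the finitely many blocks
it meets. -/
theorem exists_finset_forall_commute {τ : Equiv.Perm (I × ℤˣ)} (hτ : τ ∈ finitaryPerm (I × ℤˣ)) :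
    ∃ J : Finset I, ∀ f : I → ℤˣ, (∀ i ∈ J, f i = 1) → Commute τ (blockPerm I f) := by
  classical
  refine ⟨(mem_finitaryPerm.1 hτ).toFinset.image Prod.fst, fun f hf => ?_⟩
  refine Equiv.Perm.Disjoint.commute fun p => or_iff_not_imp_left.2 fun hp => ?_
  ext
  · rfl
  · simp [hf p.1 (Finset.mem_image.2 ⟨p, by simpa using hp, rfl⟩)]

theorem exists_finitaryPerm_apply_eq {α : Type u} {a b p q : α} (hab : a ≠ b) (hpq : p ≠ q) :
    ∃ τ ∈ finitaryPerm α, τ a = p ∧ τ b = q ∧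
      ∀ x, x ≠ a → x ≠ b → x ≠ p → x ≠ q → τ x = x := by
  classical
  have hb : Equiv.swap a p b ≠ p := fun h => hab (by
    simpa using (congrArg (Equiv.swap a p) h).symm)
  refine ⟨Equiv.swap (Equiv.swap a p b) q * Equiv.swap a p,
    mul_mem (swap_mem_finitaryPerm _ _) (swap_mem_finitaryPerm _ _), ?_, ?_, ?_⟩
  · simp [Equiv.swap_apply_of_ne_of_ne hb.symm hpq]
  · simp
  · intro x h1 h2 h3 h4
    rw [Equiv.Perm.mul_apply, Equiv.swap_apply_of_ne_of_ne h1 h3]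
    refine Equiv.swap_apply_of_ne_of_ne (fun h => h2 ?_) h4
    have := congrArg (Equiv.swap a p) h
    rwa [Equiv.swap_apply_self, Equiv.swap_apply_of_ne_of_ne h1 h3] at this

theorem conj_swap {α : Type u} [DecidableEq α] (τ : Equiv.Perm α) (a b : α) :
    τ * Equiv.swap a b * τ⁻¹ = Equiv.swap (τ a) (τ b) := by
  rw [Equiv.mul_swap_eq_swap_mul, mul_inv_cancel_right]

/-- A non-trivial group of permutations of an infinite set that is normalised by the finitary
permutations contains a product of two disjoint transpositions. -/
theorem exists_swap_mul_swap_mem {α : Type u} [DecidableEq α] [Infinite α]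
    {M : Subgroup (Equiv.Perm α)} (hM : M ≠ ⊥)
    (hconj : ∀ τ ∈ finitaryPerm α, ∀ σ ∈ M, τ * σ * τ⁻¹ ∈ M) :
    ∃ a b c d : α, a ≠ b ∧ c ≠ d ∧ a ≠ c ∧ a ≠ d ∧ b ≠ c ∧ b ≠ d ∧
      Equiv.swap a b * Equiv.swap c d ∈ M := by
  obtain ⟨σ, hσM, hσ1⟩ := M.bot_or_exists_ne_one.resolve_left hM
  obtain ⟨x, hx⟩ : ∃ x, σ x ≠ x := by
    by_contra! h
    exact hσ1 (Equiv.ext h)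
  obtain ⟨t, ht⟩ := Infinite.exists_notMem_finset {x, σ x, σ⁻¹ x}
  simp only [Finset.mem_insert, Finset.mem_singleton, not_or] at ht
  obtain ⟨htx, hty, htx'⟩ := ht
  have hσt : σ t ≠ x := fun h => htx' (by simp [← h])
  have hyt : σ x ≠ σ t := fun h => htx (σ.injective h).symm
  -- the commutator of `σ` and a transposition
  have hc : Equiv.swap (σ x) (σ t) * Equiv.swap x t ∈ M := by
    have h := mul_mem hσM (hconj _ (swap_mem_finitaryPerm x t) _ (inv_mem hσM))
    rwa [Equiv.swap_inv, ← mul_assoc, ← mul_assoc, conj_swap] at h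
  by_cases hst : σ t = t
  · -- the commutator is a `3`-cycle, and the product of two `3`-cycles sharing two points in the
    -- same cyclic order is a double transposition
    rw [hst] at hc
    generalize σ x = y at hc hx hty
    obtain ⟨s, hs⟩ := Infinite.exists_notMem_finset {x, y, t}
    simp only [Finset.mem_insert, Finset.mem_singleton, not_or] at hs
    obtain ⟨hsx, hsy, hst⟩ := hs
    refine ⟨x, t, y, s, Ne.symm htx, Ne.symm hsy, hx.symm, Ne.symm hsx, hty, Ne.symm hst, ?_⟩
    have h := mul_mem hc (hconj _ (swap_mem_finitaryPerm t s) _ hc)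
    have e : Equiv.swap y t * Equiv.swap x t * (Equiv.swap t s *
        (Equiv.swap y t * Equiv.swap x t) * (Equiv.swap t s)⁻¹) =
        Equiv.swap x t * Equiv.swap y s := by
      rw [← conj_mul, conj_swap, conj_swap,
        Equiv.swap_apply_of_ne_of_ne (Ne.symm hty) (Ne.symm hsy),
        Equiv.swap_apply_of_ne_of_ne (Ne.symm htx) (Ne.symm hsx), Equiv.swap_apply_left]
      ext z
      simp only [Equiv.Perm.mul_apply, Equiv.swap_apply_def]
      grind
    rwa [e] at h
  · exact ⟨_, _, _, _, hyt, Ne.symm htx, hx, Ne.symm hty, hσt, hst, hc⟩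

/-- The group-theoretic core of the topological simplicity of `blockPermGroup I`. The hypothesis
`hclosed` says that the part of `M` in `blockPermGroup I` is closed for the group topology having as
a base at the identity the subgroups of block permutations trivial on a given finite set of
blocks. -/
theorem blockPermGroup_le_of_ne_bot [Infinite I] {M : Subgroup (Equiv.Perm (I × ℤˣ))}
    (hM : M ≠ ⊥) (hconj : ∀ τ ∈ finitaryPerm (I × ℤˣ), ∀ σ ∈ M, τ * σ * τ⁻¹ ∈ M)
    (hclosed : ∀ σ ∈ blockPermGroup I,
      (∀ J : Finset I, ∃ f : I → ℤˣ, (∀ i ∈ J, f i = 1) ∧ σ * blockPerm I f ∈ M) → σ ∈ M) :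
    blockPermGroup I ≤ M := by
  classical
  obtain ⟨a, b, c, d, hab, hcd, hac, had, hbc, hbd, h⟩ := exists_swap_mul_swap_mem hM hconj
  have hF : finitaryPerm (I × ℤˣ) ≤ M := by
    refine finitaryPerm_le fun p q hpq => hclosed _
      (finitaryPerm_le_blockPermGroup (swap_mem_finitaryPerm _ _)) fun J => ?_
    -- a transposition is the limit of its products with the transpositions of far away blocks
    obtain ⟨i, hi⟩ := Infinite.exists_notMem_finset
      (J ∪ {a.1, b.1, c.1, d.1, p.1, q.1})
    simp only [Finset.mem_union, Finset.mem_insert, Finset.mem_singleton, not_or] at hi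
    obtain ⟨hiJ, hia, hib, hic, hid, hip, hiq⟩ := hi
    have far : ∀ {x : I × ℤˣ} {e : ℤˣ}, i ≠ x.1 → x ≠ (i, e) := by
      rintro x e h rfl
      exact h rfl
    refine ⟨Pi.mulSingle i (-1), fun j hj => ?_, ?_⟩
    · rw [Pi.mulSingle_eq_of_ne]
      rintro rfl
      exact hiJ hj
    rw [blockPerm_mulSingle]
    have hne : (i, (1 : ℤˣ)) ≠ (i, -1) := by simp
    obtain ⟨τ, hτ, hτc, hτd, hτ'⟩ := exists_finitaryPerm_apply_eq hcd hne
    have h1 := hconj τ hτ _ h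
    rw [← conj_mul, conj_swap, conj_swap, hτc, hτd,
      hτ' a hac had (far hia) (far hia), hτ' b hbc hbd (far hib) (far hib)] at h1
    obtain ⟨ρ, hρ, hρa, hρb, hρ'⟩ := exists_finitaryPerm_apply_eq hab hpq
    have h2 := hconj ρ hρ _ h1
    rwa [← conj_mul, conj_swap, conj_swap, hρa, hρb,
      hρ' _ (far hia).symm (far hib).symm (far hip).symm (far hiq).symm,
      hρ' _ (far hia).symm (far hib).symm (far hip).symm (far hiq).symm] at h2
  refine sup_le ?_ hF
  rintro _ ⟨f, rfl⟩
  refine hclosed _ (blockPerm_mem f) fun J => ?_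
  refine ⟨f⁻¹ * fun i => if i ∈ J then f i else 1, fun i hi => by simp [hi], ?_⟩
  rw [← map_mul, mul_inv_cancel_left]
  refine hF (mem_finitaryPerm.2 ((J ×ˢ Finset.univ).finite_toSet.subset fun p hp => ?_))
  by_contra hpJ
  have : p.1 ∉ J := fun h => hpJ (Finset.mem_product.2 ⟨h, Finset.mem_univ _⟩)
  exact hp (by ext <;> simp [this])

end BlockPerm

/-! ### A topologically simple totally disconnected locally compact group of large weight -/

/-- The group `blockPermGroup I` as a type of its own, so that it can carry the topology in which
the block permutations form an open subgroup with the product topology. -/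
def BlockGroup (I : Type u) : Type u := blockPermGroup I

namespace BlockGroup

variable {I : Type u}

instance : Group (BlockGroup I) := inferInstanceAs (Group (blockPermGroup I))

/-- The block permutations in `BlockGroup I`. -/
def blockHom (I : Type u) : (I → ℤˣ) →* BlockGroup I :=
  (blockPerm I).codRestrict (blockPermGroup I) blockPerm_mem

/-- The inclusion of `BlockGroup I` into the symmetric group. -/
def toPerm (I : Type u) : BlockGroup I →* Equiv.Perm (I × ℤˣ) := (blockPermGroup I).subtype

theorem toPerm_injective : Function.Injective (toPerm I) := Subtype.val_injective

@[simp]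
theorem toPerm_blockHom (f : I → ℤˣ) : toPerm I (blockHom I f) = blockPerm I f := rfl

theorem blockHom_injective : Function.Injective (blockHom I) := fun _ _ h =>
  blockPerm_injective (congrArg (toPerm I) h)

/-- The block permutations that are trivial on the blocks in `J`. -/
def blockNhd (J : Finset I) : Subgroup (BlockGroup I) :=
  (Subgroup.pi (J : Set I) fun _ => ⊥).map (blockHom I)

theorem mem_blockNhd {J : Finset I} {g : BlockGroup I} :
    g ∈ blockNhd J ↔ ∃ f : I → ℤˣ, (∀ i ∈ J, f i = 1) ∧ blockHom I f = g := by
  simp [blockNhd, Subgroup.mem_pi]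

theorem blockNhd_anti {J J' : Finset I} (h : J ⊆ J') : blockNhd J' ≤ blockNhd J := fun g hg => by
  obtain ⟨f, hf, rfl⟩ := mem_blockNhd.1 hg
  exact mem_blockNhd.2 ⟨f, fun i hi => hf i (h hi), rfl⟩

theorem exists_blockNhd_conj (g : BlockGroup I) (J : Finset I) :
    ∃ J' : Finset I, ∀ h ∈ blockNhd J', g * h * g⁻¹ ∈ blockNhd J := by
  classical
  obtain ⟨f, τ, hτ, hg⟩ := mem_blockPermGroup.1 g.2
  obtain ⟨J', hJ'⟩ := exists_finset_forall_commute hτ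
  refine ⟨J ∪ J', fun h hh => ?_⟩
  obtain ⟨k, hk, rfl⟩ := mem_blockNhd.1 hh
  refine mem_blockNhd.2 ⟨k, fun i hi => hk i (Finset.mem_union_left _ hi), toPerm_injective ?_⟩
  have hg' : toPerm I g = blockPerm I f * τ := hg.symm
  have hc : blockPerm I f * blockPerm I k = blockPerm I k * blockPerm I f := by
    rw [← map_mul, ← map_mul, mul_comm]
  rw [map_mul, map_mul, map_inv, toPerm_blockHom, hg', eq_mul_inv_iff_mul_eq, mul_assoc,
    (hJ' k fun i hi => hk i (Finset.mem_union_right _ hi)).eq, ← mul_assoc, ← mul_assoc, hc]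

/-- The base at the identity defining the topology of `BlockGroup I`. -/
abbrev groupFilterBasis (I : Type u) : GroupFilterBasis (BlockGroup I) where
  sets := Set.range fun J : Finset I => (blockNhd J : Set (BlockGroup I))
  nonempty := Set.range_nonempty _
  inter_sets := by
    classical
    rintro _ _ ⟨J, rfl⟩ ⟨J', rfl⟩
    exact ⟨_, ⟨J ∪ J', rfl⟩, Set.subset_inter (blockNhd_anti Finset.subset_union_left)
      (blockNhd_anti Finset.subset_union_right)⟩
  one' := by
    rintro _ ⟨J, rfl⟩
    exact one_mem _
  mul' := by
    rintro _ ⟨J, rfl⟩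
    exact ⟨_, ⟨J, rfl⟩, Set.mul_subset_iff.2 fun _ hx _ hy => mul_mem hx hy⟩
  inv' := by
    rintro _ ⟨J, rfl⟩
    exact ⟨_, ⟨J, rfl⟩, fun _ hx => inv_mem hx⟩
  conj' := by
    rintro g _ ⟨J, rfl⟩
    obtain ⟨J', hJ'⟩ := exists_blockNhd_conj g J
    exact ⟨_, ⟨J', rfl⟩, hJ'⟩

instance : TopologicalSpace (BlockGroup I) := (groupFilterBasis I).topology

instance : IsTopologicalGroup (BlockGroup I) := (groupFilterBasis I).isTopologicalGroup

theorem nhds_one_hasBasis :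
    (𝓝 (1 : BlockGroup I)).HasBasis (fun _ : Finset I => True) fun J => blockNhd J := by
  refine ⟨fun s => ?_⟩
  rw [(groupFilterBasis I).nhds_one_hasBasis.mem_iff]
  constructor
  · rintro ⟨_, ⟨J, rfl⟩, h⟩
    exact ⟨J, trivial, h⟩
  · rintro ⟨J, -, h⟩
    exact ⟨_, ⟨J, rfl⟩, h⟩

theorem isOpen_blockNhd (J : Finset I) : IsOpen (blockNhd J : Set (BlockGroup I)) :=
  (blockNhd J).isOpen_of_mem_nhds (nhds_one_hasBasis.mem_of_mem trivial)

instance : T2Space (BlockGroup I) := by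
  refine ((groupFilterBasis I).t2Space_iff_sInter_subset rfl).2 fun g hg => ?_
  obtain ⟨f, -, rfl⟩ := mem_blockNhd.1 (hg _ ⟨∅, rfl⟩)
  suffices f = 1 by rw [this, map_one]; rfl
  funext i
  obtain ⟨f', hf', h⟩ := mem_blockNhd.1 (hg _ ⟨{i}, rfl⟩)
  rw [← blockHom_injective h]
  exact hf' i (Finset.mem_singleton_self i)

instance : NonarchimedeanGroup (BlockGroup I) where
  is_nonarchimedean U hU := by
    obtain ⟨J, -, hJ⟩ := nhds_one_hasBasis.mem_iff.1 hU
    exact ⟨⟨blockNhd J, isOpen_blockNhd J⟩, hJ⟩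

theorem continuous_blockHom : Continuous (blockHom I) := by
  refine continuous_of_continuousAt_one _ ?_
  rw [ContinuousAt, map_one, nhds_one_hasBasis.tendsto_right_iff]
  intro J _
  have : ∀ᶠ f : I → ℤˣ in 𝓝 1, ∀ i ∈ J, f i = 1 := by
    refine (Filter.eventually_all_finset J).2 fun i _ => ?_
    have h := (continuous_apply (A := fun _ : I => ℤˣ) i).tendsto 1
    exact h.eventually ((discreteTopology_iff_singleton_mem_nhds.1 inferInstance) 1)
  exact this.mono fun f hf => mem_blockNhd.2 ⟨f, hf, rfl⟩

theorem isOpen_range_blockHom : IsOpen ((blockHom I).range : Set (BlockGroup I)) := by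
  refine Subgroup.isOpen_mono (H₁ := blockNhd ∅) ?_ (isOpen_blockNhd ∅)
  rintro g hg
  obtain ⟨f, -, rfl⟩ := mem_blockNhd.1 hg
  exact ⟨f, rfl⟩

theorem isCompact_range_blockHom : IsCompact ((blockHom I).range : Set (BlockGroup I)) := by
  rw [MonoidHom.coe_range]
  exact isCompact_range continuous_blockHom

instance : LocallyCompactSpace (BlockGroup I) :=
  isCompact_range_blockHom.locallyCompactSpace_of_mem_nhds_of_group
    (isOpen_range_blockHom.mem_nhds (one_mem _))

theorem range_blockHom_ne_top [Nontrivial I] : (blockHom I).range ≠ ⊤ := fun h => by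
  classical
  obtain ⟨i, j, hij⟩ := exists_pair_ne I
  obtain ⟨f, hf⟩ : (⟨Equiv.swap (i, 1) (j, 1), finitaryPerm_le_blockPermGroup
      (swap_mem_finitaryPerm _ _)⟩ : BlockGroup I) ∈ (blockHom I).range := h ▸ Subgroup.mem_top _
  have := congrArg (fun g => (toPerm I g (i, 1)).1) hf
  exact hij (this.trans (congrArg Prod.fst (Equiv.swap_apply_left _ _)))

theorem isTopologicallySimple [Infinite I] : IsTopologicallySimple (BlockGroup I) where
  nontrivial := by
    obtain ⟨i⟩ : Nonempty I := inferInstance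
    have : Nontrivial ℤˣ := ⟨1, -1, by decide⟩
    exact blockHom_injective.nontrivial
  eq_bot_or_eq_top M hM hMc := by
    refine or_iff_not_imp_left.2 fun hM1 => ?_
    have hle : blockPermGroup I ≤ M.map (toPerm I) := by
      refine blockPermGroup_le_of_ne_bot ?_ ?_ ?_
      · rwa [Ne, Subgroup.map_eq_bot_iff_of_injective _ toPerm_injective]
      · rintro τ hτ _ ⟨m, hm, rfl⟩
        exact ⟨_, hM.conj_mem m hm ⟨τ, finitaryPerm_le_blockPermGroup hτ⟩, rfl⟩
      · intro σ hσ h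
        obtain ⟨g, rfl⟩ : ∃ g, toPerm I g = σ := ⟨⟨σ, hσ⟩, rfl⟩
        refine ⟨g, hMc.closure_subset (mem_closure_iff_nhds.2 fun V hV => ?_), rfl⟩
        have hV' : (g * ·) ⁻¹' V ∈ 𝓝 1 :=
          (continuous_const_mul _).continuousAt.preimage_mem_nhds (by rwa [mul_one])
        obtain ⟨J, -, hJ⟩ := nhds_one_hasBasis.mem_iff.1 hV'
        obtain ⟨f, hf, m, hm, hmf⟩ := h J
        refine ⟨m, ?_, hm⟩
        rw [show m = g * blockHom I f from toPerm_injective hmf]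
        exact hJ (mem_blockNhd.2 ⟨f, hf, rfl⟩)
    refine (Subgroup.eq_top_iff' M).2 fun g => ?_
    obtain ⟨m, hm, hmg⟩ := hle g.2
    rwa [← toPerm_injective hmg]

/-- Given a base at the identity, choose for each member a finite set of blocks outside of which
it contains all block permutations; these finite sets have to cover `I`. -/
theorem mk_le_localWeight (hI : ℵ₀ < #I) : #I ≤ localWeight (BlockGroup I) := by
  classical
  have : Nonempty {S : Set (Set (BlockGroup I)) // (∀ U ∈ S, IsOpen U ∧ 1 ∈ U) ∧
      ∀ V ∈ 𝓝 (1 : BlockGroup I), ∃ U ∈ S, U ⊆ V} :=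
    ⟨{U | IsOpen U ∧ 1 ∈ U}, fun U hU => hU, fun V hV => by
      obtain ⟨U, hUV, hU, h1⟩ := mem_nhds_iff.1 hV
      exact ⟨U, ⟨hU, h1⟩, hUV⟩⟩
  refine le_ciInf fun ⟨S, hS, hS'⟩ => ?_
  have hJ : ∀ U : S, ∃ J : Finset I, (blockNhd J : Set (BlockGroup I)) ⊆ U := fun U => by
    obtain ⟨J, -, hJ⟩ := nhds_one_hasBasis.mem_iff.1 ((hS U U.2).1.mem_nhds (hS U U.2).2)
    exact ⟨J, hJ⟩
  choose J hJ using hJ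
  have hcover : ⋃ U : S, (J U : Set I) = Set.univ := by
    refine Set.eq_univ_of_forall fun i => ?_
    obtain ⟨U, hU, hUi⟩ := hS' _ ((isOpen_blockNhd {i}).mem_nhds (one_mem _))
    refine Set.mem_iUnion.2 ⟨⟨U, hU⟩, ?_⟩
    by_contra hi
    obtain ⟨f, hf, h⟩ := mem_blockNhd.1 (hUi (hJ ⟨U, hU⟩ (mem_blockNhd.2
      ⟨Pi.mulSingle i (-1), fun j hj => Pi.mulSingle_eq_of_ne (ne_of_mem_of_not_mem hj hi) _,
        rfl⟩)))
    have := congrFun (blockHom_injective h) i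
    rw [hf i (Finset.mem_singleton_self i), Pi.mulSingle_eq_same] at this
    exact absurd this (by decide)
  by_contra! hlt
  refine (mul_lt_of_lt hI.le hlt hI).not_ge ?_
  rw [← mk_univ (α := I), ← hcover]
  refine (mk_iUnion_le _).trans (mul_le_mul_right ?_ _)
  exact ciSup_le' fun U => (J U).finite_toSet.lt_aleph0.le

end BlockGroup

/-! ### The topology of semidirect products and wreath products -/

namespace SemidirectProduct

section Topology

variable {A : Type u} {B : Type v} [Group A] [Group B] [TopologicalSpace A] [TopologicalSpace B]
  {φ : B →* MulAut A}

theorem continuous_left : Continuous (left : A ⋊[φ] B → A) :=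
  continuous_fst.comp (continuous_induced_dom (f := fun k : A ⋊[φ] B => (k.left, k.right)))

theorem continuous_right : Continuous (right : A ⋊[φ] B → B) :=
  continuous_snd.comp (continuous_induced_dom (f := fun k : A ⋊[φ] B => (k.left, k.right)))

theorem continuous_iff {Y : Type w} [TopologicalSpace Y] {f : Y → A ⋊[φ] B} :
    Continuous f ↔ Continuous (fun y => (f y).left) ∧ Continuous fun y => (f y).right :=
  continuous_induced_rng.trans continuous_prodMk

variable (φ) in
/-- A semidirect product is homeomorphic to the product of its two factors. -/
def homeomorphProd : A ⋊[φ] B ≃ₜ A × B where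
  toEquiv := equivProd
  continuous_toFun := continuous_induced_dom
  continuous_invFun := continuous_iff.2 ⟨continuous_fst, continuous_snd⟩

theorem continuous_inl : Continuous (inl : A → A ⋊[φ] B) :=
  continuous_iff.2 ⟨continuous_id, continuous_const⟩

theorem continuous_inr : Continuous (inr : B → A ⋊[φ] B) :=
  continuous_iff.2 ⟨continuous_const, continuous_id⟩

theorem isOpenMap_rightHom : IsOpenMap (rightHom : A ⋊[φ] B →* B) :=
  isOpenMap_snd.comp (homeomorphProd φ).isOpenMap

theorem isTopologicalGroup [IsTopologicalGroup A] [IsTopologicalGroup B]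
    (hφ : Continuous fun p : B × A => φ p.1 p.2) : IsTopologicalGroup (A ⋊[φ] B) where
  continuous_mul := by
    have h1 : Continuous fun p : (A ⋊[φ] B) × (A ⋊[φ] B) => φ p.1.right p.2.left :=
      hφ.comp ((continuous_right.comp continuous_fst).prodMk
        (continuous_left.comp continuous_snd))
    exact continuous_iff.2 ⟨(continuous_left.comp continuous_fst).mul h1,
      (continuous_right.comp continuous_fst).mul (continuous_right.comp continuous_snd)⟩
  continuous_inv := continuous_iff.2
    ⟨hφ.comp (continuous_right.inv.prodMk continuous_left.inv), continuous_right.inv⟩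

end Topology

end SemidirectProduct

namespace WreathProduct

open SemidirectProduct

section

variable {N : Type u} {G : Type v} {X : Type w} [Group N] [Group G] [MulAction G X]

theorem aut_apply (g : G) (f : X → N) (x : X) :
    (mulAutArrow : G →* MulAut (X → N)) g f x = f (g⁻¹ • x) := rfl

theorem aut_mulSingle [DecidableEq X] (g : G) (x : X) (n : N) :
    (mulAutArrow : G →* MulAut (X → N)) g (Pi.mulSingle x n) = Pi.mulSingle (g • x) n := by
  funext y
  rw [aut_apply]
  rcases eq_or_ne y (g • x) with rfl | h
  · simp
  · rw [Pi.mulSingle_eq_of_ne h, Pi.mulSingle_eq_of_ne]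
    exact fun h' => h (by rw [← h', smul_inv_smul])

theorem base_eq_ker : base N G X = (rightHom : WreathProduct N G X →* G).ker :=
  range_inl_eq_ker_rightHom

theorem mem_base {k : WreathProduct N G X} : k ∈ base N G X ↔ k.right = 1 := by
  rw [base_eq_ker]
  rfl

instance base_normal : (base N G X).Normal := base_eq_ker (N := N) (G := G) (X := X) ▸ inferInstance

section Topology

variable [TopologicalSpace N] [TopologicalSpace G]

/-- The action on the Cartesian power is continuous if the action on `X` is continuous for the
discrete topology of `X`. -/
theorem continuous_aut [ContinuousInv G] (hX : ∀ x y : X, IsOpen {g : G | g • x = y}) :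
    Continuous fun p : G × (X → N) => (mulAutArrow : G →* MulAut (X → N)) p.1 p.2 := by
  refine continuous_pi fun x => continuous_iff_continuousAt.2 fun ⟨g₀, f₀⟩ => ?_
  have hev : ∀ᶠ p : G × (X → N) in 𝓝 (g₀, f₀), p.1⁻¹ • x = g₀⁻¹ • x :=
    ((hX x (g₀⁻¹ • x)).preimage (continuous_inv.comp continuous_fst)).mem_nhds
      (show g₀⁻¹ • x = _ from rfl)
  have hc : Continuous fun p : G × (X → N) => p.2 (g₀⁻¹ • x) :=
    (continuous_apply _).comp continuous_snd
  refine hc.continuousAt.congr (hev.mono fun p hp => ?_)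
  simp only [aut_apply, hp]

theorem isClosed_base [T1Space G] : IsClosed (base N G X : Set (WreathProduct N G X)) := by
  rw [base_eq_ker]
  exact isClosed_singleton.preimage continuous_right

/-- The constant functions form a connected subgroup of the base group. -/
theorem not_totallyDisconnectedSpace [ConnectedSpace N] [Nontrivial N] [Nonempty X] :
    ¬ TotallyDisconnectedSpace (WreathProduct N G X) := fun _ => by
  let c : N → WreathProduct N G X := fun n => inl fun _ => n
  have hc : Continuous c :=
    SemidirectProduct.continuous_inl.comp (continuous_pi fun _ => continuous_id)
  obtain ⟨a, b, hab⟩ := exists_pair_ne N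
  obtain ⟨x⟩ := ‹Nonempty X›
  have := (isPreconnected_range hc).subsingleton ⟨a, rfl⟩ ⟨b, rfl⟩
  exact hab (congrFun (inl_injective this) x)

end Topology

/-! ### Closed normal subgroups of wreath products -/

/-- A normal subgroup meeting the base group trivially centralises it; but only elements of `G`
fixing all points and only central elements of `N` can contribute to the centraliser. -/
theorem eq_bot_of_disjoint_base [Nontrivial N] [FaithfulSMul G X]
    (hN : Subgroup.center N = ⊥) {M : Subgroup (WreathProduct N G X)} (hM : M.Normal)
    (h : Disjoint M (base N G X)) : M = ⊥ := by
  classical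
  refine (Subgroup.eq_bot_iff_forall M).2 fun m hm => ?_
  have key : ∀ (f : X → N) (x : X), m.left x * f (m.right⁻¹ • x) = f x * m.left x := by
    intro f x
    have hc : m * inl f = inl f * m :=
      Subgroup.commute_of_normal_of_disjoint M _ hM base_normal h m (inl f) hm ⟨f, rfl⟩
    have := congrFun (congrArg left hc) x
    simpa only [mul_left, left_inl, right_inl, map_one, MulAut.one_apply, Pi.mul_apply,
      aut_apply] using this
  have hr : m.right = 1 := by
    refine eq_of_smul_eq_smul (α := X) fun x => ?_
    rw [one_smul]
    by_contra hx
    obtain ⟨n, hn⟩ := exists_ne (1 : N)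
    have := key (Pi.mulSingle x n) (m.right • x)
    rw [inv_smul_smul, Pi.mulSingle_eq_same, Pi.mulSingle_eq_of_ne hx, one_mul] at this
    exact hn (mul_eq_left.1 this)
  have hl : m.left = 1 := by
    funext x
    have : m.left x ∈ Subgroup.center N := Subgroup.mem_center_iff.2 fun n => by
      simpa [hr] using (key (fun _ => n) x).symm
    simpa [hN] using this
  ext1
  · exact hl
  · exact hr

variable [TopologicalSpace N] [TopologicalSpace G]

/-- A normal subgroup containing an element `f ≠ 1` of the base group contains commutators of `f`
supported at a single point, hence one and then all coordinate subgroups. -/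
theorem base_le_of_not_disjoint [IsSimpleGroup N] [MulAction.IsPretransitive G X]
    (hN : Subgroup.center N = ⊥) {M : Subgroup (WreathProduct N G X)} (hM : M.Normal)
    (hMc : IsClosed (M : Set (WreathProduct N G X))) (h : ¬ Disjoint M (base N G X)) :
    base N G X ≤ M := by
  classical
  have hinl : ∃ f : X → N, inl f ∈ M ∧ f ≠ 1 := by
    rw [Subgroup.disjoint_def] at h
    push Not at h
    obtain ⟨_, hm, ⟨f, rfl⟩, hf⟩ := h
    exact ⟨f, hm, fun hf1 => hf (by rw [hf1, map_one])⟩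
  obtain ⟨f, hfM, hf⟩ := hinl
  obtain ⟨x, hx⟩ := Function.ne_iff.1 hf
  have hfx : f x ∉ Subgroup.center N := by simpa [hN] using hx
  rw [Subgroup.mem_center_iff] at hfx
  push Not at hfx
  obtain ⟨n, hn⟩ := hfx
  let i : N →* WreathProduct N G X := inl.comp (MonoidHom.mulSingle (fun _ : X => N) x)
  have hi : ∀ n, i n = inl (Pi.mulSingle x n) := fun n => rfl
  have htop : M.comap i = ⊤ := by
    refine (IsSimpleGroup.eq_bot_or_eq_top_of_normal _ (hM.comap i)).resolve_left fun hbot => ?_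
    have hmem : f x * n * (f x)⁻¹ * n⁻¹ ∈ M.comap i := by
      have hc : i (f x * n * (f x)⁻¹ * n⁻¹) = inl f * (i n * (inl f)⁻¹ * (i n)⁻¹) := by
        rw [hi, hi, ← map_inv, ← map_inv, ← map_mul, ← map_mul, ← map_mul]
        congr 1
        funext y
        rcases eq_or_ne y x with rfl | hy
        · simp [mul_assoc]
        · simp [hy]
      rw [Subgroup.mem_comap, hc]
      exact mul_mem hfM (hM.conj_mem _ (inv_mem hfM) _)
    rw [hbot, Subgroup.mem_bot, mul_inv_eq_one, mul_inv_eq_iff_eq_mul] at hmem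
    exact hn hmem.symm
  have hsingle : ∀ (y : X) (n : N), inl (Pi.mulSingle y n) ∈ M := by
    intro y n
    obtain ⟨g, rfl⟩ := MulAction.exists_smul_eq G x y
    rw [← aut_mulSingle, inl_aut, map_inv]
    exact hM.conj_mem _ (show n ∈ M.comap i from htop ▸ Subgroup.mem_top n) _
  -- `M` is closed and the elements of finite support are dense in the base group
  rintro _ ⟨f, rfl⟩
  have htends : Filter.Tendsto (fun J : Finset X => fun y => if y ∈ J then f y else 1)
      Filter.atTop (𝓝 f) := by
    refine tendsto_pi_nhds.2 fun y => tendsto_const_nhds.congr' ?_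
    filter_upwards [Filter.eventually_ge_atTop {y}] with J hJ
    rw [if_pos (hJ (Finset.mem_singleton_self y))]
  refine hMc.mem_of_tendsto ((SemidirectProduct.continuous_inl.tendsto f).comp htends)
    (Filter.Eventually.of_forall fun J => ?_)
  refine Submonoid.pi_mem_of_mulSingle_mem_aux (H := M.comap inl) J _ (fun y hy => if_neg hy)
    fun y _ => hsingle y _

/-- The subgroups between the base group and the wreath product correspond to those of `G`. -/
theorem eq_base_or_eq_top (hG : IsTopologicallySimple G) {M : Subgroup (WreathProduct N G X)}
    (hM : M.Normal) (hMc : IsClosed (M : Set (WreathProduct N G X))) (h : base N G X ≤ M) :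
    M = base N G X ∨ M = ⊤ := by
  have hmem : ∀ m : WreathProduct N G X, m ∈ M ↔ m.right ∈ M.comap (inr : G →* _) := fun m => by
    rw [Subgroup.mem_comap]
    conv_lhs => rw [← inl_left_mul_inr_right m]
    exact Subgroup.mul_mem_cancel_left _ (h ⟨m.left, rfl⟩)
  refine (hG.eq_bot_or_eq_top (M.comap inr) (hM.comap _)
    (hMc.preimage SemidirectProduct.continuous_inr)).imp
    (fun hbot => ?_) fun htop => ?_
  · ext m
    rw [hmem, hbot, Subgroup.mem_bot, mem_base]
  · exact (Subgroup.eq_top_iff' M).2 fun m => (hmem m).2 (htop ▸ Subgroup.mem_top _)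

theorem normal_and_isClosed_iff [T2Space N] [T2Space G] [IsSimpleGroup N] [FaithfulSMul G X]
    [MulAction.IsPretransitive G X] (hN : Subgroup.center N = ⊥) (hG : IsTopologicallySimple G)
    (M : Subgroup (WreathProduct N G X)) :
    (M.Normal ∧ IsClosed (M : Set (WreathProduct N G X))) ↔
      (M = ⊥ ∨ M = base N G X ∨ M = ⊤) := by
  constructor
  · rintro ⟨hM, hMc⟩
    by_cases h : Disjoint M (base N G X)
    · exact Or.inl (eq_bot_of_disjoint_base hN hM h)
    · exact Or.inr (eq_base_or_eq_top hG hM hMc (base_le_of_not_disjoint hN hM hMc h))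
  · have : T2Space (WreathProduct N G X) := (homeomorphProd _).symm.t2Space
    rintro (rfl | rfl | rfl)
    · exact ⟨inferInstance, by rw [Subgroup.coe_bot]; exact isClosed_singleton⟩
    · exact ⟨base_normal, isClosed_base⟩
    · exact ⟨inferInstance, by rw [Subgroup.coe_top]; exact isClosed_univ⟩

end

/-! ### Cardinal invariants of the quotients -/

section

variable {N G X : Type u} [Group N] [Group G] [MulAction G X] [TopologicalSpace N]
  [TopologicalSpace G]

/-- The quotient by a subgroup of the base group maps onto `G`, continuously and openly. -/
theorem le_invariants_quotient {M : Subgroup (WreathProduct N G X)} [M.Normal]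
    (h : M ≤ base N G X) :
    localWeight G ≤ localWeight (WreathProduct N G X ⧸ M) ∧
      density G ≤ density (WreathProduct N G X ⧸ M) := by
  let p : WreathProduct N G X ⧸ M →* G :=
    QuotientGroup.lift M rightHom fun m hm => mem_base.1 (h hm)
  have hp : Continuous p := continuous_right.quotient_lift _
  have hs : Function.Surjective p := fun g => ⟨QuotientGroup.mk (inr g), rfl⟩
  have ho : IsOpenMap p := fun U hU => by
    rw [← Set.image_preimage_eq U (QuotientGroup.mk_surjective (s := M)), ← Set.image_comp]
    exact isOpenMap_rightHom _ (hU.preimage continuous_quot_mk)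
  exact ⟨localWeight_le_of_isOpenMap p hp ho, density_le_of_surjective hp hs⟩

end

end WreathProduct

section CosetAction

variable {G : Type u} [Group G] [TopologicalSpace G] [IsTopologicalGroup G] {H : Subgroup G}

theorem isOpen_setOf_smul_eq (hH : IsOpen (H : Set G)) (x y : G ⧸ H) :
    IsOpen {g : G | g • x = y} := by
  have := QuotientGroup.discreteTopology hH
  obtain ⟨a, rfl⟩ := QuotientGroup.mk_surjective x
  have hc : Continuous fun g : G => (QuotientGroup.mk (g * a) : G ⧸ H) :=
    continuous_quot_mk.comp (continuous_mul_const a)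
  exact (isOpen_discrete {y}).preimage hc

/-- The kernel of the action on `G ⧸ H` is a closed normal subgroup contained in `H`. -/
theorem IsTopologicallySimple.faithfulSMul (hG : IsTopologicallySimple G)
    (hH : IsOpen (H : Set G)) (hne : H ≠ ⊤) : FaithfulSMul G (G ⧸ H) := by
  have hcl : IsClosed (H.normalCore : Set G) := by
    have he : (H.normalCore : Set G) = ⋂ a : G, {g | a * g * a⁻¹ ∈ (H : Set G)} := by
      ext g
      simp [Subgroup.normalCore]
    rw [he]
    exact isClosed_iInter fun a => (H.isClosed_of_isOpen hH).preimage (by fun_prop)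
  have hbot : H.normalCore = ⊥ := (hG.eq_bot_or_eq_top _ inferInstance hcl).resolve_right
    fun h => hne (top_le_iff.1 (h ▸ H.normalCore_le))
  rw [Subgroup.normalCore_eq_ker] at hbot
  exact ⟨fun {g₁ g₂} h => (MonoidHom.ker_eq_bot_iff _).1 hbot (Equiv.ext h)⟩

end CosetAction

/-! ### A connected compact simple group -/

section UnitQuaternions

open scoped Quaternion

theorem Quaternion.exists_coord_eq (x y z w : ℝ) :
    ∃ q : ℍ[ℝ], q.re = x ∧ q.imI = y ∧ q.imJ = z ∧ q.imK = w :=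
  ⟨⟨x, y, z, w⟩, rfl, rfl, rfl, rfl⟩

/-- If `a` and `b` have the same real part and norm, then `b * x - x * star a` intertwines `a` and
`b` for every `x`; these elements vanish for all `x` only if `a` and `b` are equal reals. -/
theorem Quaternion.exists_ne_zero_mul_eq_mul {a b : ℍ[ℝ]} (hre : a.re = b.re)
    (hn : Quaternion.normSq a = Quaternion.normSq b) : ∃ p : ℍ[ℝ], p ≠ 0 ∧ p * a = b * p := by
  by_cases h : ∃ x : ℍ[ℝ], b * x - x * star a ≠ 0
  · obtain ⟨x, hx⟩ := h
    refine ⟨_, hx, ?_⟩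
    have ha : star a = ((2 * b.re : ℝ) : ℍ[ℝ]) - a :=
      eq_sub_of_add_eq' (hre ▸ Quaternion.self_add_star' a)
    have hb : star b = ((2 * b.re : ℝ) : ℍ[ℝ]) - b :=
      eq_sub_of_add_eq' (Quaternion.self_add_star' b)
    have ha' : star a * a = ((Quaternion.normSq b : ℝ) : ℍ[ℝ]) := hn ▸ Quaternion.star_mul_self a
    have hb' := Quaternion.star_mul_self b
    rw [hb, sub_mul, sub_eq_iff_eq_add', ← sub_eq_iff_eq_add] at hb'
    rw [sub_mul, mul_assoc x, ha', mul_sub, ← mul_assoc, ← hb', ha, mul_sub, mul_sub, sub_mul,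
      ← mul_assoc b x a, Quaternion.coe_mul_eq_smul, Quaternion.mul_coe_eq_smul,
      Quaternion.mul_coe_eq_smul, Quaternion.coe_mul_eq_smul, mul_smul_comm, smul_mul_assoc]
    abel
  · push Not at h
    have h1 := h 1
    obtain ⟨i, hi0, hi1, hi2, hi3⟩ := Quaternion.exists_coord_eq 0 1 0 0
    obtain ⟨j, hj0, hj1, hj2, hj3⟩ := Quaternion.exists_coord_eq 0 0 1 0
    have hI := h i
    have hJ := h j
    refine ⟨1, one_ne_zero, ?_⟩
    simp only [Quaternion.ext_iff] at h1 hI hJ ⊢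
    simp [hi0, hi1, hi2, hi3, hj0, hj1, hj2, hj3] at h1 hI hJ ⊢
    refine ⟨?_, ?_, ?_, ?_⟩ <;> linarith

theorem Quaternion.isConj_unitSphere {a b : Metric.sphere (0 : ℍ[ℝ]) 1}
    (h : (a : ℍ[ℝ]).re = (b : ℍ[ℝ]).re) : IsConj a b := by
  obtain ⟨p, hp, hpab⟩ := Quaternion.exists_ne_zero_mul_eq_mul h (by
    rw [Quaternion.normSq_eq_norm_mul_self, Quaternion.normSq_eq_norm_mul_self,
      norm_eq_of_mem_sphere, norm_eq_of_mem_sphere])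
  refine isConj_iff.2 ⟨⟨‖p‖⁻¹ • p, by simp [norm_smul, hp]⟩, ?_⟩
  rw [mul_inv_eq_iff_eq_mul]
  ext1
  simp [hpab]

theorem Quaternion.eq_one_of_one_le_re {a : Metric.sphere (0 : ℍ[ℝ]) 1}
    (h : 1 ≤ (a : ℍ[ℝ]).re) : a = 1 := by
  have hn : Quaternion.normSq (a : ℍ[ℝ]) = 1 := by
    rw [Quaternion.normSq_eq_norm_mul_self, norm_eq_of_mem_sphere, mul_one]
  rw [Quaternion.normSq_def'] at hn
  ext1
  rw [Metric.unitSphere.coe_one]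
  ext <;> simp <;> nlinarith

instance : ConnectedSpace (Metric.sphere (0 : ℍ[ℝ]) 1) :=
  Subtype.connectedSpace (isConnected_sphere
    (by rw [Quaternion.rank_eq_four]; norm_num) 0 zero_le_one)

/-- If `q ∈ M` is not central, then the real part of the commutators `x * q * x⁻¹ * q⁻¹` takes all
values in some interval `[c, 1]` with `c < 1`. As unit quaternions with equal real parts are
conjugate, `M` is a neighbourhood of the identity. -/
theorem Quaternion.eq_top_of_not_le_center {M : Subgroup (Metric.sphere (0 : ℍ[ℝ]) 1)}
    (hM : M.Normal) (h : ¬ M ≤ Subgroup.center _) : M = ⊤ := by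
  obtain ⟨q, hqM, hq⟩ := SetLike.not_le_iff_exists.1 h
  rw [Subgroup.mem_center_iff] at hq
  push Not at hq
  obtain ⟨p, hp⟩ := hq
  let F : Metric.sphere (0 : ℍ[ℝ]) 1 → ℝ := fun x => ((x * q * x⁻¹ * q⁻¹ : _) : ℍ[ℝ]).re
  have hF : Continuous F := Quaternion.continuous_re.comp (continuous_subtype_val.comp
    (((continuous_id.mul continuous_const).mul continuous_inv).mul continuous_const))
  have hF1 : F 1 = 1 := by simp [F, -Metric.unitSphere.coe_mul]
  have hFp : F p < 1 := by
    by_contra! hle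
    have := Quaternion.eq_one_of_one_le_re hle
    rw [mul_inv_eq_one, mul_inv_eq_iff_eq_mul] at this
    exact hp this
  have hsub : {r : Metric.sphere (0 : ℍ[ℝ]) 1 | F p < (r : ℍ[ℝ]).re} ⊆ M := by
    intro r hr
    have hr1 : (r : ℍ[ℝ]).re ≤ F 1 := by
      rw [hF1]
      by_contra! hlt
      exact hlt.ne' (by rw [Quaternion.eq_one_of_one_le_re hlt.le]; simp)
    obtain ⟨x, hx⟩ := intermediate_value_univ p 1 hF ⟨le_of_lt hr, hr1⟩
    obtain ⟨c, hc⟩ := isConj_iff.1 (Quaternion.isConj_unitSphere hx)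
    rw [← hc]
    exact hM.conj_mem _ (mul_mem (hM.conj_mem q hqM x) (inv_mem hqM)) c
  have hopen : IsOpen (M : Set (Metric.sphere (0 : ℍ[ℝ]) 1)) := by
    refine M.isOpen_of_mem_nhds (g := 1) (Filter.mem_of_superset (IsOpen.mem_nhds ?_ ?_) hsub)
    · exact isOpen_lt continuous_const (Quaternion.continuous_re.comp continuous_subtype_val)
    · simpa using hFp
  exact SetLike.coe_injective
    (IsClopen.eq_univ ⟨M.isClosed_of_isOpen hopen, hopen⟩ ⟨1, one_mem M⟩)

theorem Subgroup.isClosed_center (G : Type u) [Group G] [TopologicalSpace G] [IsTopologicalGroup G]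
    [T2Space G] : IsClosed (Subgroup.center G : Set G) := by
  have : (Subgroup.center G : Set G) = ⋂ g : G, {x | g * x = x * g} := by
    ext x
    simp [Subgroup.mem_center_iff]
  rw [this]
  exact isClosed_iInter fun g => isClosed_eq (by fun_prop) (by fun_prop)

instance : IsClosed (Subgroup.center (Metric.sphere (0 : ℍ[ℝ]) 1) :
    Set (Metric.sphere (0 : ℍ[ℝ]) 1)) :=
  Subgroup.isClosed_center _

/-- The unit quaternions modulo their centre; this group is isomorphic to `SO(3)`. -/
abbrev UnitQuaternionsModCenter : Type :=
  Metric.sphere (0 : ℍ[ℝ]) 1 ⧸ Subgroup.center (Metric.sphere (0 : ℍ[ℝ]) 1)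

instance : ConnectedSpace UnitQuaternionsModCenter :=
  QuotientGroup.mk_surjective.connectedSpace continuous_quot_mk

instance : IsSimpleGroup UnitQuaternionsModCenter where
  exists_pair_ne := by
    have h : Subgroup.center (Metric.sphere (0 : ℍ[ℝ]) 1) ≠ ⊤ := fun h => by
      obtain ⟨i, hi0, hi1, hi2, hi3⟩ := Quaternion.exists_coord_eq 0 1 0 0
      obtain ⟨j, hj0, hj1, hj2, hj3⟩ := Quaternion.exists_coord_eq 0 0 1 0
      have hi : i ∈ Metric.sphere (0 : ℍ[ℝ]) 1 := by
        rw [mem_sphere_zero_iff_norm, ← sq_eq_sq₀ (norm_nonneg _) zero_le_one, sq,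
          ← Quaternion.normSq_eq_norm_mul_self, Quaternion.normSq_def', hi0, hi1, hi2, hi3]
        norm_num
      have hj : j ∈ Metric.sphere (0 : ℍ[ℝ]) 1 := by
        rw [mem_sphere_zero_iff_norm, ← sq_eq_sq₀ (norm_nonneg _) zero_le_one, sq,
          ← Quaternion.normSq_eq_norm_mul_self, Quaternion.normSq_def', hj0, hj1, hj2, hj3]
        norm_num
      have hij := Subgroup.mem_center_iff.1 (h ▸ Subgroup.mem_top (⟨i, hi⟩ : Metric.sphere _ _))
        ⟨j, hj⟩
      have := congrArg (fun q : Metric.sphere (0 : ℍ[ℝ]) 1 => (q : ℍ[ℝ]).imK) hij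
      simp [hi0, hi1, hi2, hi3, hj0, hj1, hj2, hj3] at this
      norm_num at this
    exact (QuotientGroup.nontrivial_iff.2 h).exists_pair_ne
  eq_bot_or_eq_top_of_normal M hM := by
    have hsurj := QuotientGroup.mk'_surjective (Subgroup.center (Metric.sphere (0 : ℍ[ℝ]) 1))
    by_cases h : M.comap (QuotientGroup.mk' _) ≤ Subgroup.center (Metric.sphere (0 : ℍ[ℝ]) 1)
    · left
      rw [← Subgroup.map_comap_eq_self_of_surjective hsurj M, Subgroup.map_eq_bot_iff,
        QuotientGroup.ker_mk']
      exact h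
    · right
      rw [← Subgroup.map_comap_eq_self_of_surjective hsurj M,
        Quaternion.eq_top_of_not_le_center (hM.comap _) h, Subgroup.map_top_of_surjective _ hsurj]

end UnitQuaternions

/-- An abelian simple group is finite, hence it is not a connected Hausdorff group. -/
theorem IsSimpleGroup.center_eq_bot_of_connectedSpace (N : Type u) [Group N] [TopologicalSpace N]
    [T2Space N] [ConnectedSpace N] [IsSimpleGroup N] : Subgroup.center N = ⊥ := by
  refine (IsSimpleGroup.eq_bot_or_eq_top_of_normal _ inferInstance).resolve_right fun h => ?_
  have hcomm : IsMulCommutative N := ⟨⟨fun a b =>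
    (Subgroup.mem_center_iff.1 (h ▸ Subgroup.mem_top b) a)⟩⟩
  have hfin : Finite N :=
    Nat.finite_of_card_ne_zero (Group.is_simple_iff_prime_card.1 ‹IsSimpleGroup N›).ne_zero
  exact not_subsingleton N PreconnectedSpace.trivial_of_discrete

/-! ### The wreath product of a compact simple group and a block permutation group -/

theorem mainTheorem8 :
    (∀ μ : Cardinal.{u}, ℵ₀ ≤ μ →
      ∃ (N : Type u) (_ : Group N) (_ : TopologicalSpace N)
        (G : Type u) (_ : Group G) (_ : TopologicalSpace G) (H : Subgroup G),
        -- `N` is a connected compact simple group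
        (IsTopologicalGroup N ∧ T2Space N ∧ CompactSpace N ∧ ConnectedSpace N ∧
          IsSimpleGroup N) ∧
        -- `G` is a topologically simple totally disconnected locally compact group
        (IsTopologicalGroup G ∧ T2Space G ∧ LocallyCompactSpace G ∧
          TotallyDisconnectedSpace G ∧ IsTopologicallySimple G) ∧
        -- `H` is a proper compact open subgroup of `G` of large weight
        (IsOpen (H : Set G) ∧ IsCompact (H : Set G) ∧ H ≠ ⊤ ∧
          μ ≤ cardinalLn (weight H)) ∧
        -- `N ≀ G` is a locally compact group that is not totally disconnected
        (IsTopologicalGroup (WreathProduct N G (G ⧸ H)) ∧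
          T2Space (WreathProduct N G (G ⧸ H)) ∧
          LocallyCompactSpace (WreathProduct N G (G ⧸ H)) ∧
          ¬ TotallyDisconnectedSpace (WreathProduct N G (G ⧸ H))) ∧
        -- its closed normal subgroups are exactly `1`, `N ^ X` and the whole group
        (∀ M : Subgroup (WreathProduct N G (G ⧸ H)),
          (M.Normal ∧ IsClosed (M : Set (WreathProduct N G (G ⧸ H)))) ↔
            (M = ⊥ ∨ M = WreathProduct.base N G (G ⧸ H) ∨ M = ⊤)) ∧
        -- every non-trivial quotient group has large local weight and density
        (∀ (M : Subgroup (WreathProduct N G (G ⧸ H))) [M.Normal],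
          IsClosed (M : Set (WreathProduct N G (G ⧸ H))) → M ≠ ⊤ →
            2 ^ μ ≤ localWeight (WreathProduct N G (G ⧸ H) ⧸ M) ∧
            μ ≤ density (WreathProduct N G (G ⧸ H) ⧸ M))) ∧
    -- not every non-totally-disconnected locally compact group has a
    -- non-trivial separable quotient group
    ¬ (∀ (L : Type u) [Group L] [TopologicalSpace L] [IsTopologicalGroup L] [T2Space L]
        [LocallyCompactSpace L], ¬ TotallyDisconnectedSpace L →
        ∃ M : Subgroup L, M.Normal ∧ IsClosed (M : Set L) ∧ M ≠ ⊤ ∧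
          SeparableSpace (L ⧸ M)) := by
  refine (and_iff_left_of_imp fun main h => ?_).2 fun μ hμ => ?_
  · obtain ⟨N, _, _, G, _, _, H, -, -, -, ⟨hK, hT2, hLC, hTD⟩, -, hquot⟩ :=
      main ℵ₁ aleph0_lt_aleph_one.le
    obtain ⟨M, hM, hMc, hMne, hsep⟩ := h (WreathProduct N G (G ⧸ H)) hTD
    exact aleph0_lt_aleph_one.not_ge
      ((hquot M hMc hMne).2.trans (density_le_aleph0 _))
  · -- twice exponentiating makes `2 ^ μ < #I`, which bounds the logarithm of the weight
    let I : Type u := Set (Set μ.out)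
    have hI : 2 ^ μ < #I := by
      rw [mk_set, mk_set, mk_out]
      exact cantor _
    have hI₀ : ℵ₀ < #I := hμ.trans_lt ((cantor μ).trans hI)
    have hInf : Infinite I := infinite_iff.2 hI₀.le
    have hlw : 2 ^ μ < localWeight (BlockGroup I) := hI.trans_le (BlockGroup.mk_le_localWeight hI₀)
    let N : Type u := ULift.{u} UnitQuaternionsModCenter
    have hNc : ConnectedSpace N := Homeomorph.ulift.symm.surjective.connectedSpace
      Homeomorph.ulift.symm.continuous
    have hNs : IsSimpleGroup N := MulEquiv.ulift.isSimpleGroup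
    have hN : Subgroup.center N = ⊥ := IsSimpleGroup.center_eq_bot_of_connectedSpace N
    let G := BlockGroup I
    let H : Subgroup G := (BlockGroup.blockHom I).range
    have hG : IsTopologicallySimple G := BlockGroup.isTopologicallySimple
    have hH : IsOpen (H : Set G) := BlockGroup.isOpen_range_blockHom
    have hHne : H ≠ ⊤ := BlockGroup.range_blockHom_ne_top
    have hfaith := hG.faithfulSMul hH hHne
    let e := SemidirectProduct.homeomorphProd (mulAutArrow : G →* MulAut (G ⧸ H → N))
    have hclosed := WreathProduct.normal_and_isClosed_iff (X := G ⧸ H) hN hG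
    exact ⟨N, inferInstance, inferInstance, G, inferInstance, inferInstance, H,
      ⟨inferInstance, inferInstance, inferInstance, hNc, hNs⟩,
      ⟨inferInstance, inferInstance, inferInstance, inferInstance, hG⟩,
      ⟨hH, BlockGroup.isCompact_range_blockHom, hHne,
        le_cardinalLn_of_two_power_lt (hlw.trans_le (H.localWeight_le_weight_of_isOpen hH))⟩,
      ⟨SemidirectProduct.isTopologicalGroup
          (WreathProduct.continuous_aut (isOpen_setOf_smul_eq hH)),
        e.symm.t2Space, e.isClosedEmbedding.locallyCompactSpace,
        WreathProduct.not_totallyDisconnectedSpace⟩,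
      hclosed, fun M hM hMc hMne => by
        have hle : M ≤ WreathProduct.base N G (G ⧸ H) := by
          rcases (hclosed M).1 ⟨hM, hMc⟩ with rfl | rfl | rfl
          · exact bot_le
          · exact le_rfl
          · exact absurd rfl hMne
        obtain ⟨h1, h2⟩ := WreathProduct.le_invariants_quotient hle
        exact ⟨hlw.le.trans h1, (le_density_of_two_power_lt_localWeight hlw).trans h2⟩⟩
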